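/- Let $A\in\mathbb{R}^{n\times n}$, $B\in\mathbb{R}^{n\times p}$, $L\in\mathbb{R}^{p\times n}$, and let $X=X^\top=\begin{bmatrix}X^{11}&X^{12}\\X^{21}&X^{22}\end{bmatrix}\in\mathbb{R}^{2n\times 2n}$ have $n\times n$ blocks with $X^{22}<0$ (negative definite). Consider the system $\dot x(t)=(A+BL)x(t)+\eta(t)$ with input $\eta(t)\in\mathbb{R}^n$ and output $y(t)=x(t)\in\mathbb{R}^n$. Every $x^*\in\mathbb{R}^n$ is an equilibrium state of it, for the unique equilibrium input $\eta^*=-(A+BL)x^*$. Let $\mathcal{X}\subseteq\mathbb{R}^n$ be any nonempty set of equilibrium states (e.g. $\mathbb{R}^n$ or $\{0\}$). The system is called $X$-EID (equilibrium-independent dissipative, from $\eta$ to $x$) if there is a continuously differentiable function $V:\mathbb{R}^n\times\mathcal{X}\to\mathbb{R}$ such that, for all $(x,x^*,\eta)\in\mathbb{R}^n\times\mathcal{X}\times\mathbb{R}^n$: $V(x,x^*)>0$ if $x\neq x^*$, $V(x^*,x^*)=0$, and $$\nabla_xV(x,x^*)\big((A+BL)x+\eta\big)\le\begin{bmatrix}\eta-\eta^*\\x-x^*\end{bmatrix}^\top\begin{bmatrix}X^{11}&X^{12}\\X^{21}&X^{22}\end{bmatrix}\begin{bmatrix}\eta-\eta^*\\x-x^*\end{bmatrix}.$$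 Then the system is $X$-EID if and only if there exist a symmetric positive definite $P\in\mathbb{R}^{n\times n}$ and a matrix $K\in\mathbb{R}^{p\times n}$ such that $L=KP^{-1}$ and $$\begin{bmatrix}-(X^{22})^{-1}&P&\mathbf{0}\\P&-\mathcal{H}(AP+BK)&-\mathbf{I}+PX^{21}\\\mathbf{0}&(-\mathbf{I}+PX^{21})^\top&X^{11}\end{bmatrix}\ge 0$$ (symmetric positive semidefinite), where $\mathcal{H}(M)=M+M^\top$. -/

import Mathlib

open Matrix

/-- A dynamic system `ẋ = f(x, u)`, `y = h(x, u)` with state in `ℝⁿ`, input in `ℝ^q`, output in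
`ℝ^m` and continuously differentiable `f`, `h`. -/
structure ControlSystem (n q m : ℕ) where
  f : (Fin n → ℝ) → (Fin q → ℝ) → (Fin n → ℝ)
  h : (Fin n → ℝ) → (Fin q → ℝ) → (Fin m → ℝ)
  contDiff_f : ContDiff ℝ 1 (fun z : (Fin n → ℝ) × (Fin q → ℝ) => f z.1 z.2)
  contDiff_h : ContDiff ℝ 1 (fun z : (Fin n → ℝ) × (Fin q → ℝ) => h z.1 z.2)

/-- `𝒳` is a set of equilibrium states, each with a unique equilibrium input. -/
def ControlSystem.IsEquilibriumSet {n q m : ℕ} (S : ControlSystem n q m)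
    (𝒳 : Set (Fin n → ℝ)) : Prop :=
  ∀ xs ∈ 𝒳, ∃! us : Fin q → ℝ, S.f xs us = 0

/-- Equilibrium-independent dissipativity (EID) under the supply rate `s`, over the equilibrium
set `𝒳`. Here `xs`, `us`, `S.h xs us` are the equilibrium state, input and output. The values of
`V` matter only on `ℝⁿ × 𝒳`. -/
def ControlSystem.IsEID {n q m : ℕ} (S : ControlSystem n q m) (𝒳 : Set (Fin n → ℝ))
    (s : (Fin q → ℝ) → (Fin m → ℝ) → ℝ) : Prop :=
  S.IsEquilibriumSet 𝒳 ∧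
  ∃ V : (Fin n → ℝ) × (Fin n → ℝ) → ℝ,
    ContDiffOn ℝ 1 V (Set.univ ×ˢ 𝒳) ∧
    (∀ x, ∀ xs ∈ 𝒳, x ≠ xs → 0 < V (x, xs)) ∧
    (∀ xs ∈ 𝒳, V (xs, xs) = 0) ∧
    ∀ x, ∀ xs ∈ 𝒳, ∀ u us, S.f xs us = 0 →
      fderiv ℝ (fun z => V (z, xs)) x (S.f x u) ≤ s (u - us) (S.h x u - S.h xs us)

/-- The quadratic supply rate `[u; y]ᵀ X [u; y]`. -/
def quadraticSupply {q m : ℕ} (X : Matrix (Fin q ⊕ Fin m) (Fin q ⊕ Fin m) ℝ)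
    (u : Fin q → ℝ) (y : Fin m → ℝ) : ℝ :=
  Sum.elim u y ⬝ᵥ (X *ᵥ Sum.elim u y)

/-- `X`-EID: EID under the quadratic supply rate with coefficient matrix `X`. -/
def ControlSystem.IsXEID {n q m : ℕ} (S : ControlSystem n q m) (𝒳 : Set (Fin n → ℝ))
    (X : Matrix (Fin q ⊕ Fin m) (Fin q ⊕ Fin m) ℝ) : Prop :=
  S.IsEID 𝒳 (quadraticSupply X)

/-- The system `ẋ = (A + B L) x + η` with input `η` and output `y = x`. -/
def locallyControlledSystem {n p : ℕ} (A : Matrix (Fin n) (Fin n) ℝ)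
    (B : Matrix (Fin n) (Fin p) ℝ) (L : Matrix (Fin p) (Fin n) ℝ) : ControlSystem n n n where
  f x η := (A + B * L) *ᵥ x + η
  h x _ := x
  contDiff_f :=
    (((A + B * L).mulVecLin.toContinuousLinearMap.contDiff).comp contDiff_fst).add contDiff_snd
  contDiff_h := contDiff_fst

/-- `ℋ(M) = M + Mᵀ`. -/
def symPart {n : ℕ} (M : Matrix (Fin n) (Fin n) ℝ) : Matrix (Fin n) (Fin n) ℝ := M + Mᵀ

/-- The symmetric `3 × 3` block matrix
`[-(X²²)⁻¹, P, 0; ⋆, -ℋ(AP + BK), -I + P X²¹; ⋆, ⋆, X¹¹]`. -/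
noncomputable def synthesisMatrix {n p : ℕ} (A : Matrix (Fin n) (Fin n) ℝ)
    (B : Matrix (Fin n) (Fin p) ℝ) (X : Matrix (Fin n ⊕ Fin n) (Fin n ⊕ Fin n) ℝ)
    (P : Matrix (Fin n) (Fin n) ℝ) (K : Matrix (Fin p) (Fin n) ℝ) :
    Matrix (Fin n ⊕ (Fin n ⊕ Fin n)) (Fin n ⊕ (Fin n ⊕ Fin n)) ℝ :=
  fromBlocks (-(X.toBlocks₂₂)⁻¹) (fromCols P 0) (fromCols P 0)ᵀ
    (fromBlocks (-symPart (A * P + B * K)) (-1 + P * X.toBlocks₂₁)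
      (-1 + P * X.toBlocks₂₁)ᵀ X.toBlocks₁₁)

/-!
Take an equilibrium `xs`, put `f z = V (z + xs, xs)` and use the velocity `w = ẋ` instead of the
input as second variable: dissipativity becomes `f'(z) w ≤ [w; z]ᵀ S [w; z]`. The point is to
replace `f` by a quadratic form. Let `W ≥ 0` be a second-moment matrix of `(w, z)` under which
`E[w zᵀ + z wᵀ] = 0`. If the position block `Z` of `W` is invertible, regressing `w` on `z` gives
`w = F z` plus a residual uncorrelated with `z`, and `F Z + Z Fᵀ = 0`, so the flow of `F` preserves
`Z`. Summed over the trajectories starting at the rank-one pieces of `Z`, `f` stays bounded below,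
hence its slope bound, the part of `tr (S W)` coming from `F`, is nonnegative; the residual part is
nonnegative because `f'(0) w` is odd in `w`. So `tr (S W) ≥ 0`, also for singular `Z` by
perturbation, and a Lagrange multiplier for the constraint `E[w zᵀ + z wᵀ] = 0` is a symmetric `Q`
with `2 zᵀ Q w ≤ [w; z]ᵀ S [w; z]`. Since `X²² < 0`, along the unforced flow `zᵀ Q z` decreases and
a positive multiple of it bounds the slope of `f`; a negative value would send `f` to `-∞`, and so
`Q > 0`. Finally `P = Q⁻¹`, the substitution `z = P u` and a Schur complement turn the inequality
for `Q` into the block matrix inequality.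
-/

open Set Filter
open scoped Topology

theorem nonneg_of_bddBelow_of_deriv_le {g g' : ℝ → ℝ} {r : ℝ} (hbdd : BddBelow (range g))
    (hg : ∀ t, HasDerivAt g (g' t) t) (hle : ∀ t, 0 ≤ t → g' t ≤ r) : 0 ≤ r := by
  obtain ⟨b, hb⟩ := hbdd
  have hgrowth : ∀ t, 0 ≤ t → b ≤ g 0 + r * t := fun t ht => by
    have h := (convex_Ici (0 : ℝ)).image_sub_le_mul_sub_of_deriv_le (f := g) (C := r)
      (fun x _ => (hg x).continuousAt.continuousWithinAt)
      (fun x _ => (hg x).differentiableAt.differentiableWithinAt)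
      (fun x hx => (hg x).deriv.trans_le (hle x (interior_subset hx)))
      0 self_mem_Ici t ht ht
    linarith [hb (mem_range_self t)]
  by_contra! hr
  have hlim : Tendsto (fun t => g 0 + r * t) atTop atBot :=
    tendsto_atBot_add_const_left _ _ (tendsto_id.const_mul_atTop_of_neg hr)
  obtain ⟨t, hlt, ht⟩ := ((hlim.eventually_lt_atBot b).and (eventually_ge_atTop 0)).exists
  exact (hgrowth t ht).not_gt hlt

section Algebra

variable {m n R : Type*} [Fintype m] [Fintype n]

section CommSemiring

variable [CommSemiring R]

theorem isSymm_dotProduct_mulVec_comm {Q : Matrix n n R} (hQ : Q.IsSymm) (x y : n → R) :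
    x ⬝ᵥ Q *ᵥ y = y ⬝ᵥ Q *ᵥ x := by
  rw [dotProduct_mulVec, ← mulVec_transpose, hQ.eq, dotProduct_comm]

theorem dotProduct_transpose_mul_mul_mulVec (S : Matrix m m R) (J : Matrix m n R) (x y : n → R) :
    x ⬝ᵥ (Jᵀ * S * J) *ᵥ y = (J *ᵥ x) ⬝ᵥ S *ᵥ (J *ᵥ y) := by
  rw [← mulVec_mulVec, ← mulVec_mulVec, dotProduct_mulVec, vecMul_transpose]

theorem trace_mul_conj (S : Matrix m m R) (J : Matrix m n R) (Z : Matrix n n R) :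
    (S * (J * Z * Jᵀ)).trace = (Jᵀ * S * J * Z).trace := by
  rw [← Matrix.mul_assoc, trace_mul_comm]
  simp only [Matrix.mul_assoc]

theorem trace_mul_vecMulVec_self (N : Matrix n n R) (a : n → R) :
    (N * vecMulVec a a).trace = a ⬝ᵥ N *ᵥ a := by
  rw [mul_vecMulVec, trace_vecMulVec, dotProduct_comm]

end CommSemiring

theorem fromBlocks_eq_conj_add_conj [CommRing R] [DecidableEq m] [DecidableEq n]
    (U : Matrix m m R) (F : Matrix m n R) {Z : Matrix n n R} (hZ : Z.IsSymm) :
    fromBlocks U (F * Z) (F * Z)ᵀ Z =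
      (fromRows 1 0 : Matrix (m ⊕ n) m R) * (U - F * Z * Fᵀ) *
          (fromRows 1 0 : Matrix (m ⊕ n) m R)ᵀ +
        fromRows F 1 * Z * (fromRows F 1)ᵀ := by
  rw [transpose_fromRows, transpose_fromRows, fromRows_mul 1 0 (U - _), fromRows_mul F 1 Z,
    fromRows_mul_fromCols, fromRows_mul_fromCols, fromBlocks_add, transpose_mul, hZ.eq]
  simp only [transpose_zero, transpose_one, Matrix.one_mul, Matrix.mul_one, Matrix.zero_mul,
    Matrix.mul_zero, sub_add_cancel, zero_add]

end Algebra

section Real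

variable {m n : Type*} [Fintype m] [Fintype n]

theorem trace_mul_nonneg_of_posSemidef {N Z : Matrix n n ℝ} (hN : ∀ x, 0 ≤ x ⬝ᵥ N *ᵥ x)
    (hZ : Z.PosSemidef) : 0 ≤ (N * Z).trace := by
  obtain ⟨k, a, rfl⟩ := posSemidef_iff_eq_sum_vecMulVec.1 hZ
  simp only [star_trivial, Matrix.mul_sum, trace_sum, trace_mul_vecMulVec_self]
  exact Finset.sum_nonneg fun i _ => hN (a i)

theorem hasDerivAt_exp_smul_mulVec [DecidableEq n] (G : Matrix n n ℝ) (z : n → ℝ) (t : ℝ) :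
    HasDerivAt (fun t : ℝ => NormedSpace.exp (t • G) *ᵥ z)
      (G *ᵥ (NormedSpace.exp (t • G) *ᵥ z)) t := by
  open scoped Norms.Operator in
  have h := hasDerivAt_exp_smul_const' (𝕂 := ℝ) G t
  rw [mulVec_mulVec]
  exact ((mulVecBilin ℝ ℝ).flip z).toContinuousLinearMap.hasFDerivAt.comp_hasDerivAt t h

theorem exp_smul_mul_mul_transpose_of_add_eq_zero [DecidableEq n] {G Z : Matrix n n ℝ}
    (h : G * Z + Z * Gᵀ = 0) (t : ℝ) :
    NormedSpace.exp (t • G) * Z * (NormedSpace.exp (t • G))ᵀ = Z := by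
  have hsemi : SemiconjBy Z (t • Gᵀ) (-(t • G)) := by
    rw [SemiconjBy, Matrix.mul_smul, Matrix.neg_mul, Matrix.smul_mul, ← smul_neg,
      ← eq_neg_of_add_eq_zero_right h]
  rw [← Matrix.exp_transpose, transpose_smul]
  open scoped Norms.Operator in
  have h := hsemi.exp_neg_mul_mul_exp_eq_self
  rwa [neg_neg] at h

theorem trace_mul_nonneg_of_fderiv_le {f : (n → ℝ) → ℝ} (hf : Differentiable ℝ f)
    (hbdd : BddBelow (range f)) {N G Z : Matrix n n ℝ}
    (hd : ∀ z, fderiv ℝ f z (G *ᵥ z) ≤ z ⬝ᵥ N *ᵥ z) (hZ : Z.PosSemidef)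
    (hG : G * Z + Z * Gᵀ = 0) : 0 ≤ (N * Z).trace := by
  classical
  obtain ⟨k, a, ha⟩ := posSemidef_iff_eq_sum_vecMulVec.1 hZ
  simp only [star_trivial] at ha
  let φ : Fin k → ℝ → n → ℝ := fun i t => NormedSpace.exp (t • G) *ᵥ a i
  have hcov : ∀ t, ∑ i, vecMulVec (φ i t) (φ i t) = Z := fun t => by
    conv_rhs => rw [← exp_smul_mul_mul_transpose_of_add_eq_zero hG t, ha]
    simp only [φ, Matrix.mul_sum, Matrix.sum_mul, mul_vecMulVec, vecMulVec_mul, vecMul_transpose]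
  obtain ⟨b, hb⟩ := hbdd
  refine nonneg_of_bddBelow_of_deriv_le (g := fun t => ∑ i, f (φ i t)) ⟨∑ _i : Fin k, b, ?_⟩
    (fun t => HasDerivAt.fun_sum fun i _ =>
      (hf _).hasFDerivAt.comp_hasDerivAt t (hasDerivAt_exp_smul_mulVec G (a i) t)) fun t _ => ?_
  · rintro _ ⟨t, rfl⟩
    exact Finset.sum_le_sum fun i _ => hb (mem_range_self _)
  · calc ∑ i, fderiv ℝ f (φ i t) (G *ᵥ φ i t) ≤ ∑ i, φ i t ⬝ᵥ N *ᵥ φ i t :=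
          Finset.sum_le_sum fun i _ => hd _
      _ = (N * Z).trace := by
          rw [← hcov t, Matrix.mul_sum, trace_sum]
          exact Finset.sum_congr rfl fun i _ => (trace_mul_vecMulVec_self N _).symm

theorem exists_eq_conj_add_conj_of_posDef_toBlocks₂₂ [DecidableEq m] [DecidableEq n]
    {W : Matrix (m ⊕ n) (m ⊕ n) ℝ} (hW : W.PosSemidef) (hZ : W.toBlocks₂₂.PosDef) :
    ∃ (F : Matrix m n ℝ) (D : Matrix m m ℝ), F * W.toBlocks₂₂ = W.toBlocks₁₂ ∧ D.PosSemidef ∧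
      W = (fromRows 1 0 : Matrix (m ⊕ n) m ℝ) * D * (fromRows 1 0 : Matrix (m ⊕ n) m ℝ)ᵀ +
        fromRows F 1 * W.toBlocks₂₂ * (fromRows F 1)ᵀ := by
  have := hZ.isUnit.invertible
  obtain ⟨F, hF⟩ : ∃ F, F * W.toBlocks₂₂ = W.toBlocks₁₂ :=
    ⟨W.toBlocks₁₂ * W.toBlocks₂₂⁻¹, by simp only [inv_mul_cancel_right_of_invertible]⟩
  have h21 : W.toBlocks₁₂ᵀ = W.toBlocks₂₁ := by
    rw [← fromBlocks_toBlocks W] at hW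
    exact (isHermitian_fromBlocks_iff.1 hW.isHermitian).2.1
  have hblocks :
      W = fromBlocks W.toBlocks₁₁ (F * W.toBlocks₂₂) (F * W.toBlocks₂₂)ᵀ W.toBlocks₂₂ := by
    rw [hF, h21, fromBlocks_toBlocks]
  have hschur :
      (W.toBlocks₁₁ - F * W.toBlocks₂₂ * W.toBlocks₂₂⁻¹ * (F * W.toBlocks₂₂)ᵀ).PosSemidef :=
    (PosDef.fromBlocks₂₂ _ _ hZ).1 (hblocks ▸ hW)
  have hZs : W.toBlocks₂₂ᵀ = W.toBlocks₂₂ := hZ.isHermitian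
  rw [mul_inv_cancel_right_of_invertible, transpose_mul, hZs, ← Matrix.mul_assoc] at hschur
  exact ⟨F, _, hF, hschur, hblocks.trans (fromBlocks_eq_conj_add_conj _ _ hZs)⟩

theorem posSemidef_fromBlocks_mul_transpose {m n : Type*} [Finite m] [Fintype n] [DecidableEq n]
    (T : Matrix m n ℝ) : (fromBlocks (T * Tᵀ) T Tᵀ 1).PosSemidef := by
  have h := posSemidef_self_mul_conjTranspose (fromRows T (1 : Matrix n n ℝ))
  rwa [conjTranspose_eq_transpose_of_trivial, transpose_fromRows, fromRows_mul_fromCols,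
    transpose_one, Matrix.one_mul, Matrix.mul_one, Matrix.one_mul] at h

theorem exists_isSymm_two_mul_dotProduct_mulVec_eq (l : Matrix n n ℝ →ₗ[ℝ] ℝ) :
    ∃ Q : Matrix n n ℝ, Q.IsSymm ∧
      ∀ z w, 2 * (z ⬝ᵥ Q *ᵥ w) = l (vecMulVec z w + vecMulVec w z) := by
  classical
  let B : (n → ℝ) →ₗ[ℝ] (n → ℝ) →ₗ[ℝ] ℝ := (vecMulVecBilin ℝ ℝ).compr₂ l
  let Q : Matrix n n ℝ := LinearMap.toMatrix₂' ℝ ((1 / 2 : ℝ) • (B + B.flip))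
  have hQ : ∀ z w, 2 * (z ⬝ᵥ Q *ᵥ w) = l (vecMulVec z w + vecMulVec w z) := fun z w => by
    rw [← toLinearMap₂'_apply', toLinearMap₂'_toMatrix', map_add]
    simp only [LinearMap.smul_apply, LinearMap.add_apply, LinearMap.flip_apply, smul_eq_mul]
    change 2 * (1 / 2 * (l (vecMulVec z w) + l (vecMulVec w z))) = _
    ring
  refine ⟨Q, ?_, hQ⟩
  ext i j
  simp only [Q, transpose_apply, LinearMap.toMatrix₂'_apply, LinearMap.smul_apply,
    LinearMap.add_apply, LinearMap.flip_apply, add_comm]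

open scoped MatrixOrder in
theorem exists_pos_smul_le_of_posDef {n : Type*} [Finite n] {N Q : Matrix n n ℝ}
    (hN : N.PosDef) (hQ : Q.IsSymm) :
    ∃ κ : ℝ, 0 < κ ∧ κ • Q ≤ N := by
  classical
  cases nonempty_fintype n
  cases subsingleton_or_nontrivial (Matrix n n ℝ)
  · exact ⟨1, one_pos, (Subsingleton.elim _ _).le⟩
  obtain ⟨c, hc, hcN⟩ := (CFC.exists_pos_algebraMap_le_iff hN.isHermitian).2
    fun _ => hN.isStrictlyPositive.spectrum_pos
  obtain ⟨r, hr⟩ := (finite_real_spectrum (A := Q)).bddAbove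
  have hr₁ : 0 < max r 1 := one_pos.trans_le (le_max_right r 1)
  have hQr : Q ≤ algebraMap ℝ _ (max r 1) :=
    le_algebraMap_of_spectrum_le (fun x hx => (hr hx).trans (le_max_left r 1)) hQ
  refine ⟨c / max r 1, div_pos hc hr₁, ?_⟩
  calc (c / max r 1) • Q ≤ (c / max r 1) • algebraMap ℝ _ (max r 1) :=
        smul_le_smul_of_nonneg_left hQr (div_pos hc hr₁).le
    _ = algebraMap ℝ _ c := by
        rw [Algebra.smul_def, ← map_mul, div_mul_cancel₀ _ hr₁.ne']
    _ ≤ N := hcN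

theorem hasFDerivAt_dotProduct_mulVec_self [DecidableEq n] {Q : Matrix n n ℝ} (hQ : Q.IsSymm)
    (x : n → ℝ) :
    HasFDerivAt (fun z : n → ℝ => z ⬝ᵥ Q *ᵥ z)
      ((2 : ℝ) • (toLinearMap₂' ℝ Q x : (n → ℝ) →ₗ[ℝ] ℝ).toContinuousLinearMap) x := by
  let B : (n → ℝ) →L[ℝ] (n → ℝ) →L[ℝ] ℝ := (toLinearMap₂' ℝ Q).toContinuousBilinearMap
  have hB : ∀ y z, B y z = y ⬝ᵥ Q *ᵥ z := toLinearMap₂'_apply' Q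
  have h := B.hasFDerivAt_of_bilinear (hasFDerivAt_id x) (hasFDerivAt_id x)
  simp only [id, hB] at h
  refine h.congr_fderiv (ContinuousLinearMap.ext fun y => ?_)
  change B x y + B y x = 2 * B x y
  rw [hB, hB, isSymm_dotProduct_mulVec_comm hQ y x, two_mul]

theorem contDiff_dotProduct_mulVec_self (Q : Matrix n n ℝ) {k : WithTop ℕ∞} :
    ContDiff ℝ k (fun z : n → ℝ => z ⬝ᵥ Q *ᵥ z) := by
  classical
  let B : (n → ℝ) →L[ℝ] (n → ℝ) →L[ℝ] ℝ := (toLinearMap₂' ℝ Q).toContinuousBilinearMap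
  have hB : ∀ y z, B y z = y ⬝ᵥ Q *ᵥ z := toLinearMap₂'_apply' Q
  simpa only [id, hB] using (B.contDiff (n := k)).clm_apply contDiff_id

end Real

section Lyapunov

variable {n : Type*} [Fintype n]

theorem posSemidef_of_lyapunov {f : (n → ℝ) → ℝ} (hf : Differentiable ℝ f)
    (hbdd : BddBelow (range f)) {M N Q : Matrix n n ℝ} (hN : N.PosDef)
    (hfM : ∀ z, fderiv ℝ f z (M *ᵥ z) ≤ -(z ⬝ᵥ N *ᵥ z)) (hQ : Q.IsSymm)
    (hQM : ∀ z, z ⬝ᵥ Q *ᵥ (M *ᵥ z) ≤ 0) : Q.PosSemidef := by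
  classical
  refine .of_dotProduct_mulVec_nonneg hQ fun z₀ => ?_
  let φ : ℝ → n → ℝ := fun t => NormedSpace.exp (t • M) *ᵥ z₀
  have hφ : ∀ t, HasDerivAt φ (M *ᵥ φ t) t := hasDerivAt_exp_smul_mulVec M z₀
  have hφ₀ : φ 0 = z₀ := by simp [φ]
  obtain ⟨κ, hκ, hle⟩ := exists_pos_smul_le_of_posDef hN hQ.neg
  have hq : ∀ t, HasDerivAt (fun t => φ t ⬝ᵥ Q *ᵥ φ t) (2 * (φ t ⬝ᵥ Q *ᵥ (M *ᵥ φ t))) t :=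
    fun t => by
      rw [← toLinearMap₂'_apply']
      exact (hasFDerivAt_dotProduct_mulVec_self hQ (φ t)).comp_hasDerivAt t (hφ t)
  have hanti : Antitone fun t => φ t ⬝ᵥ Q *ᵥ φ t :=
    antitone_of_hasDerivAt_nonpos hq fun t =>
      mul_nonpos_of_nonneg_of_nonpos zero_le_two (hQM (φ t))
  have hNQ : ∀ z, -(z ⬝ᵥ N *ᵥ z) ≤ κ * (z ⬝ᵥ Q *ᵥ z) := fun z => by
    have h := (le_iff.1 hle).dotProduct_mulVec_nonneg z
    rw [star_trivial, smul_neg, sub_neg_eq_add, add_mulVec, dotProduct_add, smul_mulVec,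
      dotProduct_smul, smul_eq_mul] at h
    linarith
  have hrate : 0 ≤ κ * (z₀ ⬝ᵥ Q *ᵥ z₀) :=
    nonneg_of_bddBelow_of_deriv_le (hbdd.mono (range_comp_subset_range φ f))
      (fun t => (hf (φ t)).hasFDerivAt.comp_hasDerivAt t (hφ t)) fun t ht =>
      calc fderiv ℝ f (φ t) (M *ᵥ φ t) ≤ κ * (φ t ⬝ᵥ Q *ᵥ φ t) := (hfM _).trans (hNQ _)
        _ ≤ κ * (φ 0 ⬝ᵥ Q *ᵥ φ 0) := mul_le_mul_of_nonneg_left (hanti ht) hκ.le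
        _ = κ * (z₀ ⬝ᵥ Q *ᵥ z₀) := by rw [hφ₀]
  exact nonneg_of_mul_nonneg_right hrate hκ

theorem posDef_of_lyapunov {f : (n → ℝ) → ℝ} (hf : Differentiable ℝ f) (hbdd : BddBelow (range f))
    {M N Q : Matrix n n ℝ} (hN : N.PosDef) (hfM : ∀ z, fderiv ℝ f z (M *ᵥ z) ≤ -(z ⬝ᵥ N *ᵥ z))
    (hQ : Q.IsSymm) (hQM : ∀ z, z ≠ 0 → z ⬝ᵥ Q *ᵥ (M *ᵥ z) < 0) : Q.PosDef := by
  have hpsd : Q.PosSemidef := posSemidef_of_lyapunov hf hbdd hN hfM hQ fun z => by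
    rcases eq_or_ne z 0 with rfl | hz
    · simp
    · exact (hQM z hz).le
  refine .of_dotProduct_mulVec_pos hQ fun z hz => ?_
  refine (hpsd.dotProduct_mulVec_nonneg z).lt_of_ne' fun h => (hQM z hz).ne ?_
  rw [isSymm_dotProduct_mulVec_comm hQ, (hpsd.dotProduct_mulVec_zero_iff z).1 h, dotProduct_zero]

end Lyapunov

theorem exists_linearMap_comp_le {E F : Type*} [AddCommGroup E] [Module ℝ E] [AddCommGroup F]
    [Module ℝ F] (s : PointedCone ℝ E) (h : E →ₗ[ℝ] ℝ) (L : E →ₗ[ℝ] F)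
    (hker : ∀ x ∈ s, L x = 0 → 0 ≤ h x) (hrange : ∀ y, ∃ x ∈ s, L x = L y) :
    ∃ l : F →ₗ[ℝ] ℝ, ∀ x ∈ s, l (L x) ≤ h x := by
  obtain ⟨g, hgh, hg⟩ := riesz_extension s ⟨L.ker, h.domRestrict L.ker⟩
    (fun x hx => hker x hx x.2)
    (fun y => by
      obtain ⟨x, hx, hxy⟩ := hrange y
      exact ⟨⟨x - y, by rw [LinearMap.mem_ker, map_sub, hxy, sub_self]⟩, by
        rwa [sub_add_cancel]⟩)
  obtain ⟨l, hl⟩ : h - g ∈ LinearMap.range L.dualMap := by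
    rw [LinearMap.range_dualMap_eq_dualAnnihilator_ker, Submodule.mem_dualAnnihilator]
    intro x hx
    rw [LinearMap.sub_apply, hgh ⟨x, hx⟩]
    exact sub_self _
  refine ⟨l, fun x hx => ?_⟩
  have hlx : l (L x) = h x - g x := LinearMap.congr_fun hl x
  linarith [hg x hx]

section Storage

variable {n : Type*} [Fintype n]

/-- A storage function in velocity form: along any motion with position `z` and velocity `w`, the
growth of `f` is at most `[w; z]ᵀ S [w; z]`. The input is eliminated in favour of `w`, and only a
lower bound on `f` is retained from positive definiteness. -/
structure IsStorageFunction (f : (n → ℝ) → ℝ) (S : Matrix (n ⊕ n) (n ⊕ n) ℝ) : Prop where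
  differentiable : Differentiable ℝ f
  bddBelow : BddBelow (range f)
  fderiv_le : ∀ z w, fderiv ℝ f z w ≤ Sum.elim w z ⬝ᵥ S *ᵥ Sum.elim w z

/-- The rate of change `E[ẋ xᵀ + x ẋᵀ]` of the second moment of a position `x`, as a function of the
second-moment matrix `W` of the pair `(ẋ, x)`, velocity first. -/
def covarianceRate : Matrix (n ⊕ n) (n ⊕ n) ℝ →ₗ[ℝ] Matrix n n ℝ where
  toFun W := W.toBlocks₁₂ + W.toBlocks₁₂ᵀ
  map_add' _ _ := add_add_add_comm _ _ _ _
  map_smul' c _ := (smul_add c _ _).symm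

variable {f : (n → ℝ) → ℝ} {S : Matrix (n ⊕ n) (n ⊕ n) ℝ}

theorem IsStorageFunction.nonneg_of_position_eq_zero (hf : IsStorageFunction f S) (w : n → ℝ) :
    0 ≤ Sum.elim w 0 ⬝ᵥ S *ᵥ Sum.elim w 0 := by
  have hpos := hf.fderiv_le 0 w
  have hneg := hf.fderiv_le 0 (-w)
  have hsymm : Sum.elim (-w) (0 : n → ℝ) = -Sum.elim w 0 := by
    ext (i | i) <;> simp
  rw [hsymm, map_neg, mulVec_neg, neg_dotProduct_neg] at hneg
  linarith

variable {W : Matrix (n ⊕ n) (n ⊕ n) ℝ}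

theorem IsStorageFunction.trace_mul_nonneg_of_posDef_toBlocks₂₂ (hf : IsStorageFunction f S)
    (hW : W.PosSemidef) (hW₂₂ : W.toBlocks₂₂.PosDef) (hW₁₂ : W.toBlocks₁₂ + W.toBlocks₁₂ᵀ = 0) :
    0 ≤ (S * W).trace := by
  classical
  obtain ⟨F, D, hF, hD, hWsplit⟩ := exists_eq_conj_add_conj_of_posDef_toBlocks₂₂ hW hW₂₂
  rw [hWsplit, Matrix.mul_add, trace_add, trace_mul_conj, trace_mul_conj]
  refine add_nonneg (trace_mul_nonneg_of_posSemidef (fun w => ?_) hD)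
    (trace_mul_nonneg_of_fderiv_le hf.differentiable hf.bddBelow (G := F) (fun z => ?_)
      hW₂₂.posSemidef ?_)
  · rw [dotProduct_transpose_mul_mul_mulVec, fromRows_mulVec, one_mulVec, zero_mulVec]
    exact hf.nonneg_of_position_eq_zero w
  · rw [dotProduct_transpose_mul_mul_mulVec, fromRows_mulVec, one_mulVec]
    exact hf.fderiv_le z _
  · rw [hF]
    have hZs : W.toBlocks₂₂ᵀ = W.toBlocks₂₂ := hW₂₂.isHermitian
    conv_lhs => rw [← hZs, ← transpose_mul, hF]
    exact hW₁₂

theorem IsStorageFunction.trace_mul_nonneg (hf : IsStorageFunction f S)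
    (hW : W.PosSemidef) (hW₁₂ : W.toBlocks₁₂ + W.toBlocks₁₂ᵀ = 0) : 0 ≤ (S * W).trace := by
  classical
  let W₀ : Matrix (n ⊕ n) (n ⊕ n) ℝ := fromBlocks (0 * 0ᵀ) 0 0ᵀ 1
  have hW₀ : W₀.PosSemidef := posSemidef_fromBlocks_mul_transpose 0
  have hperturbed : ∀ ε : ℝ, 0 < ε → 0 ≤ (S * (W + ε • W₀)).trace := fun ε hε => by
    have h₂₂ : (W + ε • W₀).toBlocks₂₂ = W.toBlocks₂₂ + ε • 1 := rfl
    have h₁₂ : (W + ε • W₀).toBlocks₁₂ = W.toBlocks₁₂ + ε • 0 := rfl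
    refine hf.trace_mul_nonneg_of_posDef_toBlocks₂₂ (hW.add (hW₀.smul hε.le)) ?_ ?_
    · rw [h₂₂]
      exact PosDef.posSemidef_add (hW.submatrix Sum.inr) (PosDef.one.smul hε)
    · rwa [h₁₂, smul_zero, add_zero]
  have hcont : Continuous fun ε : ℝ => (S * (W + ε • W₀)).trace := by fun_prop
  have hlim : Tendsto (fun ε : ℝ => (S * (W + ε • W₀)).trace) (𝓝[>] 0) (𝓝 (S * W).trace) := by
    simpa using (hcont.tendsto 0).mono_left nhdsWithin_le_nhds
  exact ge_of_tendsto hlim (eventually_mem_nhdsWithin.mono hperturbed)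

open scoped MatrixOrder in
theorem IsStorageFunction.exists_quadratic (hf : IsStorageFunction f S) :
    ∃ Q : Matrix n n ℝ, Q.IsSymm ∧
      ∀ z w, 2 * (z ⬝ᵥ Q *ᵥ w) ≤ Sum.elim w z ⬝ᵥ S *ᵥ Sum.elim w z := by
  classical
  obtain ⟨l, hl⟩ := exists_linearMap_comp_le (PointedCone.positive ℝ (Matrix (n ⊕ n) (n ⊕ n) ℝ))
    (traceLinearMap (n ⊕ n) ℝ ℝ ∘ₗ LinearMap.mulLeft ℝ S) covarianceRate
    (fun W hW => hf.trace_mul_nonneg (nonneg_iff_posSemidef.1 hW))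
    (fun Y => ⟨_, nonneg_iff_posSemidef.2 (posSemidef_fromBlocks_mul_transpose Y.toBlocks₁₂), rfl⟩)
  obtain ⟨Q, hQ, hQl⟩ := exists_isSymm_two_mul_dotProduct_mulVec_eq l
  refine ⟨Q, hQ, fun z w => ?_⟩
  calc 2 * (z ⬝ᵥ Q *ᵥ w)
      = l (covarianceRate (vecMulVec (Sum.elim w z) (Sum.elim w z))) := by
        rw [hQl, add_comm, ← transpose_vecMulVec w z]
        rfl
    _ ≤ (S * vecMulVec (Sum.elim w z) (Sum.elim w z)).trace :=
        hl _ (nonneg_iff_posSemidef.2 (posSemidef_vecMulVec_self_star _))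
    _ = Sum.elim w z ⬝ᵥ S *ᵥ Sum.elim w z := trace_mul_vecMulVec_self S _

end Storage

section Supply

variable {n : ℕ} {M : Matrix (Fin n) (Fin n) ℝ} {X : Matrix (Fin n ⊕ Fin n) (Fin n ⊕ Fin n) ℝ}

/-- The coefficient matrix of the quadratic supply rate `X` in the velocity form of
`IsStorageFunction`, for `ẋ = M x + u`: the input is recovered as `u = w - M z`. -/
def velocitySupply (M : Matrix (Fin n) (Fin n) ℝ) (X : Matrix (Fin n ⊕ Fin n) (Fin n ⊕ Fin n) ℝ) :
    Matrix (Fin n ⊕ Fin n) (Fin n ⊕ Fin n) ℝ :=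
  (fromBlocks 1 (-M) 0 1)ᵀ * X * fromBlocks 1 (-M) 0 1

/-- The form `zᵀ Q z` satisfies the dissipation inequality of `ẋ = M x + u` with supply rate `X`,
written with the velocity `w` in place of the input `u = w - M z`. -/
def IsQuadraticStorage (M : Matrix (Fin n) (Fin n) ℝ)
    (X : Matrix (Fin n ⊕ Fin n) (Fin n ⊕ Fin n) ℝ) (Q : Matrix (Fin n) (Fin n) ℝ) : Prop :=
  ∀ z w, 2 * (z ⬝ᵥ Q *ᵥ w) ≤ quadraticSupply X (w - M *ᵥ z) z

theorem dotProduct_velocitySupply_mulVec (M : Matrix (Fin n) (Fin n) ℝ)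
    (X : Matrix (Fin n ⊕ Fin n) (Fin n ⊕ Fin n) ℝ) (w z : Fin n → ℝ) :
    Sum.elim w z ⬝ᵥ velocitySupply M X *ᵥ Sum.elim w z = quadraticSupply X (w - M *ᵥ z) z := by
  rw [velocitySupply, dotProduct_transpose_mul_mul_mulVec, fromBlocks_mulVec, quadraticSupply]
  simp only [Sum.elim_comp_inl, Sum.elim_comp_inr, one_mulVec, neg_mulVec, zero_mulVec, zero_add,
    sub_eq_add_neg]

theorem quadraticSupply_eq {q m : ℕ} {X : Matrix (Fin q ⊕ Fin m) (Fin q ⊕ Fin m) ℝ}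
    (hX : X.IsSymm) (u : Fin q → ℝ) (y : Fin m → ℝ) :
    quadraticSupply X u y = u ⬝ᵥ X.toBlocks₁₁ *ᵥ u + 2 * (y ⬝ᵥ X.toBlocks₂₁ *ᵥ u) +
      y ⬝ᵥ X.toBlocks₂₂ *ᵥ y := by
  rw [← fromBlocks_toBlocks X, isSymm_fromBlocks_iff] at hX
  have hcross : u ⬝ᵥ X.toBlocks₁₂ *ᵥ y = y ⬝ᵥ X.toBlocks₂₁ *ᵥ u := by
    rw [← hX.2.1, mulVec_transpose, dotProduct_comm y, dotProduct_mulVec]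
  conv_lhs => rw [quadraticSupply, ← fromBlocks_toBlocks X, fromBlocks_mulVec]
  simp only [sumElim_dotProduct_sumElim, dotProduct_add, Sum.elim_comp_inl, Sum.elim_comp_inr,
    hcross]
  ring

theorem quadraticSupply_zero_left {q m : ℕ} (X : Matrix (Fin q ⊕ Fin m) (Fin q ⊕ Fin m) ℝ)
    (y : Fin m → ℝ) : quadraticSupply X 0 y = y ⬝ᵥ X.toBlocks₂₂ *ᵥ y := by
  conv_lhs => rw [quadraticSupply, ← fromBlocks_toBlocks X, fromBlocks_mulVec]
  simp only [sumElim_dotProduct_sumElim, Sum.elim_comp_inl, Sum.elim_comp_inr, mulVec_zero,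
    zero_add, zero_dotProduct]

theorem IsStorageFunction.exists_posDef_isQuadraticStorage {f : (Fin n → ℝ) → ℝ}
    (hf : IsStorageFunction f (velocitySupply M X)) (hX₂₂ : (-X.toBlocks₂₂).PosDef) :
    ∃ Q : Matrix (Fin n) (Fin n) ℝ, Q.PosDef ∧ IsQuadraticStorage M X Q := by
  obtain ⟨Q, hQ, hQd⟩ := hf.exists_quadratic
  simp only [dotProduct_velocitySupply_mulVec] at hQd
  have hdrift : ∀ z,
      quadraticSupply X (M *ᵥ z - M *ᵥ z) z = -(z ⬝ᵥ -X.toBlocks₂₂ *ᵥ z) := fun z => by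
    rw [sub_self, quadraticSupply_zero_left, neg_mulVec, dotProduct_neg, neg_neg]
  refine ⟨Q, posDef_of_lyapunov hf.differentiable hf.bddBelow hX₂₂ (M := M) (fun z => ?_) hQ
    fun z hz => ?_, hQd⟩
  · rw [← hdrift, ← dotProduct_velocitySupply_mulVec]
    exact hf.fderiv_le z _
  · have hpos := hX₂₂.dotProduct_mulVec_pos hz
    rw [star_trivial] at hpos
    linarith [hQd z (M *ᵥ z), hdrift z]

end Supply

section Synthesis

variable {n p : ℕ} {A : Matrix (Fin n) (Fin n) ℝ} {B : Matrix (Fin n) (Fin p) ℝ}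
  {P : Matrix (Fin n) (Fin n) ℝ} {K : Matrix (Fin p) (Fin n) ℝ}
  {X : Matrix (Fin n ⊕ Fin n) (Fin n ⊕ Fin n) ℝ}

/-- The Schur complement of `-(X²²)⁻¹` in the synthesis matrix, with `N` standing for
`A P + B K`. -/
def reducedSynthesisMatrix (X : Matrix (Fin n ⊕ Fin n) (Fin n ⊕ Fin n) ℝ)
    (P N : Matrix (Fin n) (Fin n) ℝ) : Matrix (Fin n ⊕ Fin n) (Fin n ⊕ Fin n) ℝ :=
  fromBlocks (P * X.toBlocks₂₂ * P - symPart N) (-1 + P * X.toBlocks₂₁)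
    (-1 + P * X.toBlocks₂₁)ᵀ X.toBlocks₁₁

theorem posSemidef_synthesisMatrix_iff_reducedSynthesisMatrix (hX₂₂ : (-X.toBlocks₂₂).PosDef)
    (hP : P.IsSymm) :
    (synthesisMatrix A B X P K).PosSemidef ↔
      (reducedSynthesisMatrix X P (A * P + B * K)).PosSemidef := by
  have := hX₂₂.isUnit.invertible
  have hdet : IsUnit X.toBlocks₂₂.det :=
    (isUnit_iff_isUnit_det _).1 (neg_neg X.toBlocks₂₂ ▸ hX₂₂.isUnit.neg)
  have hinv : (-X.toBlocks₂₂)⁻¹ = -(X.toBlocks₂₂)⁻¹ :=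
    inv_eq_left_inv (by rw [neg_mul_neg, nonsing_inv_mul _ hdet])
  have hcorner : (-(X.toBlocks₂₂)⁻¹).PosDef := hinv ▸ hX₂₂.inv
  have hcorner_inv : (-(X.toBlocks₂₂)⁻¹)⁻¹ = -X.toBlocks₂₂ := by
    rw [← hinv, inv_inv_of_invertible]
  have := hcorner.isUnit.invertible
  rw [synthesisMatrix, ← conjTranspose_eq_transpose_of_trivial (fromCols P 0),
    PosDef.fromBlocks₁₁ _ _ hcorner, hcorner_inv, conjTranspose_eq_transpose_of_trivial,
    transpose_fromCols, hP.eq, fromRows_mul, fromRows_mul_fromCols, sub_eq_add_neg,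
    fromBlocks_neg, fromBlocks_add, reducedSynthesisMatrix]
  simp only [transpose_zero, Matrix.zero_mul, Matrix.mul_zero, neg_zero, add_zero,
    Matrix.mul_neg, Matrix.neg_mul, neg_neg, neg_add_eq_sub]

theorem isSymm_reducedSynthesisMatrix (hX : X.IsSymm) (hP : P.IsSymm)
    (N : Matrix (Fin n) (Fin n) ℝ) : (reducedSynthesisMatrix X P N).IsSymm := by
  rw [← fromBlocks_toBlocks X, isSymm_fromBlocks_iff] at hX
  have hconj : (P * X.toBlocks₂₂ * P)ᵀ = P * X.toBlocks₂₂ * P := by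
    rw [transpose_mul, transpose_mul, hP.eq, hX.2.2.2.eq, Matrix.mul_assoc]
  exact isSymm_fromBlocks_iff.2 ⟨.sub hconj (isSymm_add_transpose_self N), rfl,
    transpose_transpose _, hX.1⟩

theorem dotProduct_reducedSynthesisMatrix_mulVec (hX : X.IsSymm) (hP : P.IsSymm)
    (N : Matrix (Fin n) (Fin n) ℝ) (u v : Fin n → ℝ) :
    Sum.elim u v ⬝ᵥ reducedSynthesisMatrix X P N *ᵥ Sum.elim u v =
      quadraticSupply X v (P *ᵥ u) - 2 * (u ⬝ᵥ (N *ᵥ u + v)) := by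
  have hT : ∀ (C : Matrix (Fin n) (Fin n) ℝ) x y, x ⬝ᵥ Cᵀ *ᵥ y = y ⬝ᵥ C *ᵥ x := fun C x y => by
    rw [mulVec_transpose, dotProduct_comm, ← dotProduct_mulVec]
  have hPu : ∀ w, (P *ᵥ u) ⬝ᵥ w = u ⬝ᵥ P *ᵥ w := fun w => by
    rw [← hT, dotProduct_comm, hP.eq]
  rw [reducedSynthesisMatrix, fromBlocks_mulVec, quadraticSupply_eq hX]
  simp only [sumElim_dotProduct_sumElim, Sum.elim_comp_inl, Sum.elim_comp_inr, symPart, hPu, hT,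
    sub_mulVec, add_mulVec, neg_mulVec, one_mulVec, dotProduct_sub, dotProduct_add, dotProduct_neg,
    mulVec_mulVec, Matrix.mul_assoc]
  ring

theorem posSemidef_reducedSynthesisMatrix_iff (hX : X.IsSymm) (hP : P.IsSymm)
    (N : Matrix (Fin n) (Fin n) ℝ) :
    (reducedSynthesisMatrix X P N).PosSemidef ↔
      ∀ u v, 2 * (u ⬝ᵥ (N *ᵥ u + v)) ≤ quadraticSupply X v (P *ᵥ u) := by
  have hform := dotProduct_reducedSynthesisMatrix_mulVec hX hP N
  refine ⟨fun h u v => ?_, fun h => .of_dotProduct_mulVec_nonneg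
    (isSymm_reducedSynthesisMatrix hX hP N) fun x => ?_⟩
  · have huv := h.dotProduct_mulVec_nonneg (Sum.elim u v)
    rwa [star_trivial, hform, sub_nonneg] at huv
  · rw [star_trivial, ← Sum.elim_comp_inl_inr x, hform, sub_nonneg]
    exact h _ _

theorem posSemidef_synthesisMatrix_iff (hX : X.IsSymm) (hX₂₂ : (-X.toBlocks₂₂).PosDef)
    (hP : P.PosDef) :
    (synthesisMatrix A B X P K).PosSemidef ↔ IsQuadraticStorage (A + B * (K * P⁻¹)) X P⁻¹ := by
  have hPs : P.IsSymm := hP.isHermitian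
  have := hP.isUnit.invertible
  have hM : (A + B * (K * P⁻¹)) * P = A * P + B * K := by
    rw [Matrix.add_mul, Matrix.mul_assoc B, inv_mul_cancel_right_of_invertible]
  have hcancel : ∀ u w, (P *ᵥ u) ⬝ᵥ P⁻¹ *ᵥ w = u ⬝ᵥ w := fun u w => by
    rw [isSymm_dotProduct_mulVec_comm hPs.inv, mulVec_mulVec, inv_mul_of_invertible, one_mulVec,
      dotProduct_comm]
  rw [posSemidef_synthesisMatrix_iff_reducedSynthesisMatrix hX₂₂ hPs,
    posSemidef_reducedSynthesisMatrix_iff hX hPs, ← hM]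
  simp only [← mulVec_mulVec]
  refine ⟨fun h z w => ?_, fun h u v => ?_⟩
  · obtain ⟨u, rfl⟩ : ∃ u, P *ᵥ u = z :=
      ⟨P⁻¹ *ᵥ z, by rw [mulVec_mulVec, mul_inv_of_invertible, one_mulVec]⟩
    simpa only [hcancel, add_sub_cancel] using h u (w - (A + B * (K * P⁻¹)) *ᵥ P *ᵥ u)
  · simpa only [hcancel, add_sub_cancel_left] using
      h (P *ᵥ u) ((A + B * (K * P⁻¹)) *ᵥ P *ᵥ u + v)

end Synthesis

section Equilibrium

variable {n p : ℕ} {A : Matrix (Fin n) (Fin n) ℝ} {B : Matrix (Fin n) (Fin p) ℝ}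
  {L : Matrix (Fin p) (Fin n) ℝ} {X : Matrix (Fin n ⊕ Fin n) (Fin n ⊕ Fin n) ℝ}
  {𝒳 : Set (Fin n → ℝ)}

theorem locallyControlledSystem_f_eq_zero_iff {x u : Fin n → ℝ} :
    (locallyControlledSystem A B L).f x u = 0 ↔ u = -((A + B * L) *ᵥ x) :=
  add_eq_zero_iff_eq_neg'

theorem isEquilibriumSet_locallyControlledSystem :
    (locallyControlledSystem A B L).IsEquilibriumSet 𝒳 := fun xs _ =>
  ⟨-((A + B * L) *ᵥ xs), locallyControlledSystem_f_eq_zero_iff.2 rfl,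
    fun _ => locallyControlledSystem_f_eq_zero_iff.1⟩

theorem IsQuadraticStorage.isXEID {Q : Matrix (Fin n) (Fin n) ℝ} (hQ : Q.PosDef)
    (hd : IsQuadraticStorage (A + B * L) X Q) : (locallyControlledSystem A B L).IsXEID 𝒳 X := by
  refine ⟨isEquilibriumSet_locallyControlledSystem,
    fun w => (w.1 - w.2) ⬝ᵥ Q *ᵥ (w.1 - w.2), ?_, fun x xs _ hne => ?_, fun xs _ => ?_,
    fun x xs _ u us hus => ?_⟩
  · exact ((contDiff_dotProduct_mulVec_self Q).comp
      (contDiff_fst.sub contDiff_snd)).contDiffOn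
  · simpa only [star_trivial] using hQ.dotProduct_mulVec_pos (sub_ne_zero.2 hne)
  · simp only [sub_self, zero_dotProduct]
  · have hV : fderiv ℝ (fun z => (z - xs) ⬝ᵥ Q *ᵥ (z - xs)) x =
        (2 : ℝ) • (toLinearMap₂' ℝ Q (x - xs) : (Fin n → ℝ) →ₗ[ℝ] ℝ).toContinuousLinearMap :=
      ((hasFDerivAt_dotProduct_mulVec_self hQ.isHermitian (x - xs)).comp x
        ((hasFDerivAt_id x).sub_const xs)).fderiv
    have hinput : u - us = (locallyControlledSystem A B L).f x u - (A + B * L) *ᵥ (x - xs) := by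
      change _ = (A + B * L) *ᵥ x + u - _
      rw [locallyControlledSystem_f_eq_zero_iff.1 hus, mulVec_sub]
      abel
    rw [hV, hinput]
    change 2 * toLinearMap₂' ℝ Q (x - xs) _ ≤ _
    rw [toLinearMap₂'_apply']
    exact hd (x - xs) _

theorem exists_isStorageFunction_of_isXEID (h𝒳 : 𝒳.Nonempty)
    (h : (locallyControlledSystem A B L).IsXEID 𝒳 X) :
    ∃ f, IsStorageFunction f (velocitySupply (A + B * L) X) := by
  obtain ⟨xs, hxs⟩ := h𝒳
  obtain ⟨-, V, hV, hpos, hzero, hdiss⟩ := h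
  have hVd : Differentiable ℝ fun x => V (x, xs) :=
    (contDiffOn_univ.1 <| hV.comp (f := fun x => (x, xs))
      (contDiff_id.prodMk contDiff_const).contDiffOn fun _ _ => ⟨trivial, hxs⟩).differentiable
      one_ne_zero
  have hVnonneg : ∀ x, 0 ≤ V (x, xs) := fun x => by
    rcases eq_or_ne x xs with rfl | hne
    · exact (hzero x hxs).ge
    · exact (hpos x xs hxs hne).le
  refine ⟨fun z => V (z + xs, xs), hVd.comp (differentiable_id.add_const xs), ⟨0, ?_⟩,
    fun z w => ?_⟩
  · rintro _ ⟨z, rfl⟩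
    exact hVnonneg _
  · have hf : (locallyControlledSystem A B L).f (z + xs) (w - (A + B * L) *ᵥ (z + xs)) = w :=
      add_sub_cancel _ _
    have hy : ∀ u us, (locallyControlledSystem A B L).h (z + xs) u -
        (locallyControlledSystem A B L).h xs us = z := fun _ _ => add_sub_cancel_right z xs
    have hu : w - (A + B * L) *ᵥ (z + xs) - -((A + B * L) *ᵥ xs) = w - (A + B * L) *ᵥ z := by
      rw [mulVec_add]
      abel
    have hz := hdiss (z + xs) xs hxs (w - (A + B * L) *ᵥ (z + xs)) _
      (locallyControlledSystem_f_eq_zero_iff.2 rfl)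
    rw [hf, hy, hu] at hz
    rwa [dotProduct_velocitySupply_mulVec, fderiv_comp_add_right (f := fun x => V (x, xs))]

end Equilibrium

theorem corollary1 {n p : ℕ} (A : Matrix (Fin n) (Fin n) ℝ) (B : Matrix (Fin n) (Fin p) ℝ)
    (L : Matrix (Fin p) (Fin n) ℝ)
    (X : Matrix (Fin n ⊕ Fin n) (Fin n ⊕ Fin n) ℝ) (hX : X.IsSymm)
    (hX22 : (-X.toBlocks₂₂).PosDef)
    (𝒳 : Set (Fin n → ℝ)) (h𝒳 : 𝒳.Nonempty) :
    (locallyControlledSystem A B L).IsXEID 𝒳 X ↔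
      ∃ (P : Matrix (Fin n) (Fin n) ℝ) (K : Matrix (Fin p) (Fin n) ℝ),
        P.PosDef ∧ (synthesisMatrix A B X P K).PosSemidef ∧ L = K * P⁻¹ := by
  constructor
  · intro h
    obtain ⟨f, hf⟩ := exists_isStorageFunction_of_isXEID h𝒳 h
    obtain ⟨Q, hQ, hQd⟩ := hf.exists_posDef_isQuadraticStorage hX22
    have := hQ.isUnit.invertible
    have hL : L * Q⁻¹ * Q⁻¹⁻¹ = L := by
      rw [inv_inv_of_invertible, inv_mul_cancel_right_of_invertible]
    refine ⟨Q⁻¹, L * Q⁻¹, hQ.inv, (posSemidef_synthesisMatrix_iff hX hX22 hQ.inv).2 ?_, hL.symm⟩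
    rwa [hL, inv_inv_of_invertible]
  · rintro ⟨P, K, hP, hPK, rfl⟩
    exact ((posSemidef_synthesisMatrix_iff hX hX22 hP).1 hPK).isXEID hP.inv
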